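/- Let $k$ be a field that is complete with respect to a non-Archimedean absolute value $|\cdot|$ (possibly trivial), let $n\ge 0$, and let $\mathbf r=(r_1,\dots,r_n)$ and $\mathbf s=(s_1,\dots,s_n)$ be families of positive real numbers. Let $\mathbb D_{\mathbf r}$ denote the closed $k$-polydisc centred at the origin of polyradius $\mathbf r$, that is, the domain of the Berkovich analytic affine space $\mathbb A^{n,\mathrm{an}}_k$ defined by $|T_i|\le r_i$ for all $i$; equivalently, the $k$-affinoid space of the Banach algebra $k\{r_1^{-1}T_1,\dots,r_n^{-1}T_n\}$ of power series $\sum_I a_I T^I$ with $|a_I|\,\mathbf r^I\to 0$, with the norm $\sup_I |a_I|\,\mathbf r^I$. A $k$-analytic space is called a closed $k$-polydisc of type $\mathbf r$ if it is isomorphic to $\mathbb D_{\mathbf r}$ (as a $k$-analytic space in the sense of Berkovich; for $k$-affinoid spaces, isomorphisms correspond to isomorphisms of $k$-algebras between the affinoid algebras that are bounded together with their inverses). Let $X$ be a closed $k$-polydisc of type $\mathbf r$ and $Y$ a closed $k$-polydisc of type $\mathbf s$. Then $X$ and $Y$ are isomorphic if and only if there is a permutation $\sigma$ of $\{1,\dots,n\}$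 such that $s_{\sigma(i)}\,r_i^{-1}\in |k^\times|$ for every $i\in\{1,\dots,n\}$. -/

import Mathlib

open Filter Topology CategoryTheory

noncomputable section

universe u v

namespace Berkovich

/-! ### The Banach algebra `k{r⁻¹T}` -/

section TateAlgebra

variable (k : Type u) [NormedField k] [IsUltrametricDist k] {n : ℕ}
  (r : Fin n → {x : ℝ // 0 < x})

/-- The algebra `k{r₁⁻¹T₁, …, rₙ⁻¹Tₙ}` of the power series `∑ a_I T^I` over `k` such that
`|a_I| r^I` tends to `0` as `|I|` tends to infinity. -/
def TateAlgebra : Subalgebra k (MvPowerSeries (Fin n) k) where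
  __ := MvPowerSeries.IsRestricted.subring (fun i => (r i : ℝ))
  algebraMap_mem' a := MvPowerSeries.isRestricted_C _ a

namespace TateAlgebra

variable {k r}

theorem isRestricted (f : TateAlgebra k r) :
    MvPowerSeries.IsRestricted (fun i => (r i : ℝ)) (f : MvPowerSeries (Fin n) k) := f.2

theorem weight_pos (t : Fin n →₀ ℕ) : 0 < t.prod (fun i m => (r i : ℝ) ^ m) :=
  Finset.prod_pos fun i _ => pow_pos (r i).2 _

theorem hasGaussNorm (f : TateAlgebra k r) :
    MvPowerSeries.HasGaussNorm (fun a : k => ‖a‖) (fun i => (r i : ℝ))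
      (f : MvPowerSeries (Fin n) k) :=
  (isRestricted f).bddAbove_range_of_cofinite

theorem isNonarchimedean_norm : IsNonarchimedean (fun a : k => ‖a‖) :=
  fun a b => IsUltrametricDist.norm_add_le_max a b

/-- The Gauss norm `‖∑ a_I T^I‖ = sup_I |a_I| r^I`. -/
instance : Norm (TateAlgebra k r) where
  norm f := MvPowerSeries.gaussNorm (fun a : k => ‖a‖) (fun i => (r i : ℝ))
    (f : MvPowerSeries (Fin n) k)

theorem norm_def (f : TateAlgebra k r) :
    ‖f‖ = MvPowerSeries.gaussNorm (fun a : k => ‖a‖) (fun i => (r i : ℝ))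
      (f : MvPowerSeries (Fin n) k) := rfl

theorem coeff_le (f : TateAlgebra k r) (t : Fin n →₀ ℕ) :
    ‖MvPowerSeries.coeff t (f : MvPowerSeries (Fin n) k)‖ * t.prod (fun i m => (r i : ℝ) ^ m)
      ≤ ‖f‖ :=
  MvPowerSeries.le_gaussNorm _ _ _ (hasGaussNorm f) t

theorem norm_le_of_coeff (f : TateAlgebra k r) {C : ℝ}
    (h : ∀ t, ‖MvPowerSeries.coeff t (f : MvPowerSeries (Fin n) k)‖ *
      t.prod (fun i m => (r i : ℝ) ^ m) ≤ C) : ‖f‖ ≤ C :=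
  ciSup_le h

theorem weight_nonneg : (0 : Fin n → ℝ) ≤ fun i => (r i : ℝ) := fun i => (r i).2.le

theorem norm_add_le_max' (f g : TateAlgebra k r) : ‖f + g‖ ≤ max ‖f‖ ‖g‖ :=
  MvPowerSeries.gaussNorm_add_le_max _ _ _ _ weight_nonneg (fun _ => norm_nonneg _)
    isNonarchimedean_norm (hasGaussNorm f) (hasGaussNorm g)

theorem norm_nonneg' (f : TateAlgebra k r) : 0 ≤ ‖f‖ :=
  MvPowerSeries.gaussNorm_nonneg _ _ _ (fun _ => norm_nonneg _)

theorem norm_neg' (f : TateAlgebra k r) : ‖-f‖ = ‖f‖ :=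
  MvPowerSeries.gaussNorm_neg _ _ (fun a => norm_neg a) _

theorem norm_mul_le' (f g : TateAlgebra k r) : ‖f * g‖ ≤ ‖f‖ * ‖g‖ :=
  MvPowerSeries.gaussNorm_mul_le _ _ _ _ weight_nonneg (fun _ => norm_nonneg _)
    (fun a b => norm_mul_le a b) isNonarchimedean_norm norm_zero
    (hasGaussNorm f) (hasGaussNorm g)

theorem norm_eq_zero' (f : TateAlgebra k r) : ‖f‖ = 0 ↔ f = 0 := by
  rw [norm_def, MvPowerSeries.gaussNorm_eq_zero_iff _ _ _ norm_zero (fun _ => norm_nonneg _)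
    (fun x hx => norm_eq_zero.1 hx) (fun i => (r i).2) (hasGaussNorm f)]
  exact ZeroMemClass.coe_eq_zero

theorem norm_smul' (a : k) (f : TateAlgebra k r) : ‖a • f‖ ≤ ‖a‖ * ‖f‖ := by
  refine norm_le_of_coeff _ fun t => ?_
  have h := coeff_le f t
  calc _ = ‖a‖ * (‖MvPowerSeries.coeff t (f : MvPowerSeries (Fin n) k)‖ *
        t.prod (fun i m => (r i : ℝ) ^ m)) := by simp [mul_assoc]
    _ ≤ _ := by gcongr

instance : NormedCommRing (TateAlgebra k r) where
  __ := (inferInstance : CommRing (TateAlgebra k r))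
  __ := NormedAddCommGroup.ofCore (𝕜 := k) (E := TateAlgebra k r)
    { norm_nonneg := norm_nonneg'
      norm_smul := fun a f => by
        refine le_antisymm (norm_smul' a f) ?_
        rcases eq_or_ne a 0 with rfl | ha
        · simpa using norm_nonneg' _
        · have h := norm_smul' a⁻¹ (a • f)
          rw [inv_smul_smul₀ ha, norm_inv] at h
          rwa [inv_mul_eq_div, le_div_iff₀' (norm_pos_iff.2 ha)] at h
      norm_triangle := fun f g => (norm_add_le_max' f g).trans
        (max_le_add_of_nonneg (norm_nonneg' f) (norm_nonneg' g))
      norm_eq_zero_iff := norm_eq_zero' }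
  norm_mul_le := norm_mul_le'

instance : NormedAlgebra k (TateAlgebra k r) where
  norm_smul_le := norm_smul'

instance : IsUltrametricDist (TateAlgebra k r) :=
  IsUltrametricDist.isUltrametricDist_of_forall_norm_add_le_max_norm norm_add_le_max'

instance [CompleteSpace k] : CompleteSpace (TateAlgebra k r) := by
  refine Metric.complete_of_cauchySeq_tendsto fun F hF => ?_
  have key (t : Fin n →₀ ℕ) : CauchySeq fun m =>
      MvPowerSeries.coeff t (F m : MvPowerSeries (Fin n) k) := by
    rw [Metric.cauchySeq_iff] at hF ⊢
    intro ε hε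
    obtain ⟨N, hN⟩ := hF (ε * t.prod (fun i m => (r i : ℝ) ^ m)) (mul_pos hε (weight_pos t))
    refine ⟨N, fun a ha b hb => ?_⟩
    have h1 := hN a ha b hb
    have h2 := coeff_le (F a - F b) t
    rw [dist_eq_norm] at h1 ⊢
    have h3 := h2.trans_lt h1
    simpa using lt_of_mul_lt_mul_right h3 (weight_pos t).le
  choose c hc using fun t => cauchySeq_tendsto_of_complete (key t)
  let g : MvPowerSeries (Fin n) k := c
  have hg (t) : MvPowerSeries.coeff t g = c t := rfl
  have close (ε : ℝ) (hε : 0 < ε) : ∃ N, ∀ m ≥ N, ∀ t,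
      ‖MvPowerSeries.coeff t (F m : MvPowerSeries (Fin n) k) - c t‖ *
        t.prod (fun i m => (r i : ℝ) ^ m) ≤ ε := by
    obtain ⟨N, hN⟩ := Metric.cauchySeq_iff.1 hF ε hε
    refine ⟨N, fun m hm t => ?_⟩
    have hlim := ((tendsto_const_nhds (x :=
      MvPowerSeries.coeff t (F m : MvPowerSeries (Fin n) k))).sub (hc t)).norm.mul_const
        (t.prod (fun i m => (r i : ℝ) ^ m))
    refine le_of_tendsto hlim (eventually_atTop.2 ⟨N, fun b hb => ?_⟩)
    have h1 := hN m hm b hb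
    rw [dist_eq_norm] at h1
    have h2 := (coeff_le (F m - F b) t).trans h1.le
    simpa using h2
  have hgr : MvPowerSeries.IsRestricted (fun i => (r i : ℝ)) g := by
    rw [MvPowerSeries.IsRestricted, Metric.tendsto_nhds]
    intro ε hε
    obtain ⟨N, hN⟩ := close (ε / 2) (half_pos hε)
    filter_upwards [Metric.tendsto_nhds.1 (isRestricted (F N)) ε hε] with t ht
    have h1 := hN N le_rfl t
    have hw := weight_pos (r := r) t
    rw [Real.dist_0_eq_abs, abs_of_nonneg (by positivity)] at ht ⊢
    have h2 : ‖c t‖ ≤ max ‖MvPowerSeries.coeff t (F N : MvPowerSeries (Fin n) k)‖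
        ‖MvPowerSeries.coeff t (F N : MvPowerSeries (Fin n) k) - c t‖ := by
      have := IsUltrametricDist.norm_add_le_max
        (MvPowerSeries.coeff t (F N : MvPowerSeries (Fin n) k))
        (-(MvPowerSeries.coeff t (F N : MvPowerSeries (Fin n) k) - c t))
      rw [norm_neg] at this
      simpa using this
    rw [hg]
    rcases le_max_iff.1 h2 with h | h
    · exact (mul_le_mul_of_nonneg_right h hw.le).trans_lt ht
    · exact ((mul_le_mul_of_nonneg_right h hw.le).trans h1).trans_lt (half_lt_self hε)
  refine ⟨⟨g, hgr⟩, Metric.tendsto_atTop.2 fun ε hε => ?_⟩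
  obtain ⟨N, hN⟩ := close (ε / 2) (half_pos hε)
  refine ⟨N, fun m hm => ?_⟩
  rw [dist_eq_norm]
  refine lt_of_le_of_lt (norm_le_of_coeff _ fun t => ?_) (half_lt_self hε)
  simpa [hg] using hN m hm t

end TateAlgebra

end TateAlgebra

/-! ### Affinoid algebras and affinoid spaces -/

/-- A Banach `k`-algebra `A` is `k`-affinoid if there is an admissible epimorphism
`φ : k{r⁻¹T} → A`: a bounded surjective homomorphism of `k`-algebras such that the norm of `A`
is equivalent to the residue norm (every `a` has a preimage of norm at most `C ‖a‖`). -/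
def IsAffinoidAlgebra (k : Type u) [NormedField k] [IsUltrametricDist k]
    (A : Type v) [NormedCommRing A] [NormedAlgebra k A] : Prop :=
  ∃ (m : ℕ) (r : Fin m → {x : ℝ // 0 < x}) (φ : TateAlgebra k r →ₐ[k] A) (C : ℝ),
    (∀ f, ‖φ f‖ ≤ C * ‖f‖) ∧ ∀ a : A, ∃ f, φ f = a ∧ ‖f‖ ≤ C * ‖a‖

/-- A `k`-affinoid space, given by its `k`-affinoid algebra of analytic functions. Its points are
in `AffinoidSpace.Points`. -/
structure AffinoidSpace (k : Type u) [NormedField k] [IsUltrametricDist k] where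
  /-- the algebra of analytic functions -/
  functions : Type u
  [normedCommRing : NormedCommRing functions]
  [normedAlgebra : NormedAlgebra k functions]
  [isUltrametricDist : IsUltrametricDist functions]
  [completeSpace : CompleteSpace functions]
  isAffinoidAlgebra : IsAffinoidAlgebra k functions

namespace AffinoidSpace

attribute [instance] normedCommRing normedAlgebra isUltrametricDist completeSpace

variable {k : Type u} [NormedField k] [IsUltrametricDist k]

/-- The underlying set of an affinoid space: the Berkovich spectrum of its algebra of functions,
that is, the set of bounded multiplicative seminorms `f ↦ |f(x)|`. -/
def Points (X : AffinoidSpace k) : Type u :=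
  {x : MulRingSeminorm X.functions // ∀ f, x f ≤ ‖f‖}

/-- The coarsest topology for which all maps `x ↦ |f(x)|` are continuous. -/
instance (X : AffinoidSpace k) : TopologicalSpace X.Points :=
  TopologicalSpace.induced (fun x (f : X.functions) => x.1 f) inferInstance

/-- A morphism of `k`-affinoid spaces `X → Y` is a bounded homomorphism of `k`-algebras from the
functions on `Y` to the functions on `X` (the category of `k`-affinoid spaces is dual to that of
`k`-affinoid algebras, and is a full subcategory of the category of `k`-analytic spaces). -/
@[ext]
structure Hom (X Y : AffinoidSpace k) where
  /-- the pull-back of functions -/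
  comap : Y.functions →ₐ[k] X.functions
  bounded : ∃ C : ℝ, ∀ f, ‖comap f‖ ≤ C * ‖f‖

instance : Category (AffinoidSpace k) where
  Hom := Hom
  id X := ⟨AlgHom.id k X.functions, 1, fun f => by simp⟩
  comp {X Y Z} φ ψ := ⟨φ.comap.comp ψ.comap, by
    obtain ⟨C, hC⟩ := φ.bounded
    obtain ⟨D, hD⟩ := ψ.bounded
    refine ⟨|C| * D, fun f => (hC _).trans ?_⟩
    rw [mul_assoc]
    exact mul_le_mul (le_abs_self C) (hD f) (norm_nonneg _) (abs_nonneg C)⟩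

/-- A bounded multiplicative seminorm pulled back along a morphism is bounded by the norm. -/
theorem Hom.pullback_le {X Y : AffinoidSpace k} (φ : Hom X Y) (x : X.Points)
    (f : Y.functions) : x.1 (φ.comap f) ≤ ‖f‖ := by
  obtain ⟨C, hC⟩ := φ.bounded
  refine le_of_forall_gt_imp_ge_of_dense fun b hb => ?_
  have hb0 : 0 < b := (norm_nonneg f).trans_lt hb
  by_contra! hlt
  have h1 (m : ℕ) : (x.1 (φ.comap f) / b) ^ (m + 1) ≤ C := by
    have h2 : x.1 (φ.comap f) ^ (m + 1) ≤ C * ‖f ^ (m + 1)‖ := by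
      rw [← map_pow, ← map_pow]
      exact (x.2 _).trans (hC _)
    have h3 : ‖f ^ (m + 1)‖ ≤ b ^ (m + 1) :=
      (norm_pow_le' f m.succ_pos).trans (pow_le_pow_left₀ (norm_nonneg _) hb.le _)
    have hC0 : 0 ≤ C := by
      by_contra! hC0
      have h4 := pow_pos (hb0.trans hlt) (m + 1)
      have h5 := mul_nonpos_of_nonpos_of_nonneg hC0.le (norm_nonneg (f ^ (m + 1)))
      linarith
    rw [div_pow, div_le_iff₀ (pow_pos hb0 _)]
    exact h2.trans (mul_le_mul_of_nonneg_left h3 hC0)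
  have h6 := tendsto_pow_atTop_atTop_of_one_lt ((one_lt_div hb0).2 hlt)
  obtain ⟨m, hm⟩ := ((tendsto_add_atTop_iff_nat 1).2 h6 |>.eventually_gt_atTop C).exists
  exact (h1 m).not_gt hm

/-- The map of points induced by a morphism: `|f(φ(x))| = |(φ^* f)(x)|`. -/
def Hom.onPoints {X Y : AffinoidSpace k} (φ : Hom X Y) (x : X.Points) : Y.Points :=
  ⟨{ toFun := fun f => x.1 (φ.comap f)
     map_zero' := by simp
     add_le' := fun f g => by rw [map_add]; exact map_add_le_add x.1 _ _
     neg' := fun f => by rw [map_neg]; exact map_neg_eq_map x.1 _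
     map_one' := by simp
     map_mul' := fun f g => by simp }, φ.pullback_le x⟩

theorem Hom.continuous_onPoints {X Y : AffinoidSpace k} (φ : Hom X Y) :
    Continuous φ.onPoints :=
  continuous_induced_rng.2 <| continuous_pi fun f =>
    (continuous_apply (φ.comap f)).comp continuous_induced_dom

/-- The closed polydisc `𝔻_r` over `k` centred at the origin, of polyradius `r`: the affinoid
space of `k{r⁻¹T}`, i.e. the domain `|T_i| ≤ r_i` of the analytic affine space. -/
def polydisc (k : Type u) [NormedField k] [IsUltrametricDist k] [CompleteSpace k] {n : ℕ}
    (r : Fin n → {x : ℝ // 0 < x}) : AffinoidSpace k where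
  functions := TateAlgebra k r
  isAffinoidAlgebra := ⟨n, r, AlgHom.id k _, 1, fun f => by simp, fun f => ⟨f, by simp⟩⟩

/-- `X` is a closed `k`-polydisc of type `r` if it is isomorphic to `𝔻_r`. -/
def IsClosedPolydisc [CompleteSpace k] (X : AffinoidSpace k) {n : ℕ}
    (r : Fin n → {x : ℝ // 0 < x}) : Prop :=
  Nonempty (X ≅ polydisc k r)

end AffinoidSpace

end Berkovich

end

/-!
The Gauss norm is multiplicative, so it is a point of the Berkovich spectrum of the polydisc, the
Gauss point. Evaluating there shows that every bounded homomorphism from a Banach algebra to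
`k{r⁻¹T}` is a contraction. Hence an isomorphism between two polydiscs induces an isometry of their
algebras, and after a translation it fixes the origin. The Jacobian matrices `A` and `B` at the
origin of the isomorphism and of its inverse are then inverse to each other, and
`|A i j| s j ≤ r i`, `|B j i| r i ≤ s j`. Since `1 = |det A| |det B|`, the ultrametric expansion of
`det A` contains a term all of whose factors attain the bound: there is a permutation `σ` with
`|A i (σ i)| s (σ i) = r i` for every `i`. Conversely, such a permutation and such scalars define a
rescaling and renumbering of the coordinates that identifies the polydiscs.
-/

noncomputable section

namespace Berkovich

open MvPowerSeries (coeff)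

theorem isometry_of_norm_map_le_of_norm_inv_le {A B F : Type*} [SeminormedAddCommGroup A]
    [SeminormedAddCommGroup B] [EquivLike F A B] [AddEquivClass F A B] (e : F)
    (he : ∀ a, ‖e a‖ ≤ ‖a‖) (he' : ∀ b, ‖EquivLike.inv e b‖ ≤ ‖b‖) : Isometry e :=
  AddMonoidHomClass.isometry_of_norm e fun a =>
    (he a).antisymm ((congrArg norm (EquivLike.left_inv e a)).ge.trans (he' (e a)))

/-! ### Ultrametric determinants -/

section Matrix

theorem eq_of_prod_le_prod {ι : Type*} [Fintype ι] {f g : ι → ℝ} (hf : ∀ i, 0 ≤ f i)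
    (hg : ∀ i, 0 < g i) (hfg : ∀ i, f i ≤ g i) (h : ∏ i, g i ≤ ∏ i, f i) : f = g := by
  have hf' (i) : 0 < f i := by
    have hpos : 0 < ∏ i, f i := (Finset.prod_pos fun i _ => hg i).trans_le h
    exact (hf i).lt_of_ne' (Finset.prod_ne_zero_iff.1 hpos.ne' i (Finset.mem_univ i))
  by_contra hne
  obtain ⟨i, hi⟩ := Function.ne_iff.1 hne
  exact h.not_gt <| Finset.prod_lt_prod (fun i _ => hf' i) (fun i _ => hfg i)
    ⟨i, Finset.mem_univ i, (hfg i).lt_of_ne hi⟩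

variable {R ι : Type*} [NormedCommRing R] [NormOneClass R] [IsUltrametricDist R]
  [Fintype ι] [DecidableEq ι]

theorem exists_perm_norm_det_le (A : Matrix ι ι R) :
    ∃ σ : Equiv.Perm ι, ‖A.det‖ ≤ ∏ i, ‖A i (σ i)‖ := by
  obtain ⟨σ, -, hσ⟩ := IsUltrametricDist.exists_norm_finsetSum_le_of_nonempty Finset.univ_nonempty
    fun σ : Equiv.Perm ι => Equiv.Perm.sign σ • ∏ i, A i (σ i)
  have hdet : A.det = ∑ σ : Equiv.Perm ι, Equiv.Perm.sign σ • ∏ i, A i (σ i) := by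
    rw [← Matrix.det_transpose, Matrix.det_apply]
    rfl
  have hsign : ‖Equiv.Perm.sign σ • ∏ i, A i (σ i)‖ = ‖∏ i, A i (σ i)‖ := by
    rcases Int.units_eq_one_or (Equiv.Perm.sign σ) with h | h <;> simp [h]
  exact ⟨σ, (hdet ▸ hσ).trans (hsign.trans_le (Finset.norm_prod_le _ _))⟩

theorem norm_det_mul_prod_le {A : Matrix ι ι R} {r s : ι → ℝ} (hs : ∀ i, 0 ≤ s i)
    (hA : ∀ i j, ‖A i j‖ * s j ≤ r i) : ‖A.det‖ * ∏ i, s i ≤ ∏ i, r i := by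
  obtain ⟨σ, hσ⟩ := exists_perm_norm_det_le A
  calc ‖A.det‖ * ∏ i, s i ≤ (∏ i, ‖A i (σ i)‖) * ∏ i, s i := by
        gcongr
        exact Finset.prod_nonneg fun i _ => hs i
    _ = ∏ i, ‖A i (σ i)‖ * s (σ i) := by rw [Finset.prod_mul_distrib, Equiv.prod_comp σ s]
    _ ≤ ∏ i, r i :=
        Finset.prod_le_prod (fun i _ => mul_nonneg (norm_nonneg _) (hs _)) fun i _ => hA i (σ i)

theorem exists_perm_norm_mul_eq {A B : Matrix ι ι R} (hAB : A * B = 1) {r s : ι → ℝ}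
    (hr : ∀ i, 0 < r i) (hA : ∀ i j, ‖A i j‖ * s j ≤ r i) (hB : ∀ i j, ‖B i j‖ * r j ≤ s i) :
    ∃ σ : Equiv.Perm ι, ∀ i, ‖A i (σ i)‖ * s (σ i) = r i := by
  have hs (i) : 0 ≤ s i := (mul_nonneg (norm_nonneg _) (hr i).le).trans (hB i i)
  obtain ⟨σ, hσ⟩ := exists_perm_norm_det_le A
  have hdet : 1 ≤ ‖A.det‖ * ‖B.det‖ := by
    rw [← norm_one (α := R), ← Matrix.det_one (n := ι), ← hAB, Matrix.det_mul]
    exact norm_mul_le _ _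
  refine ⟨σ, congrFun <| eq_of_prod_le_prod (fun i => mul_nonneg (norm_nonneg _) (hs _)) hr
    (fun i => hA i (σ i)) ?_⟩
  calc ∏ i, r i ≤ ‖A.det‖ * ‖B.det‖ * ∏ i, r i :=
        le_mul_of_one_le_left (Finset.prod_nonneg fun i _ => (hr i).le) hdet
    _ ≤ ‖A.det‖ * ∏ i, s i := by
        rw [mul_assoc]
        gcongr
        exact norm_det_mul_prod_le (fun i => (hr i).le) hB
    _ ≤ (∏ i, ‖A i (σ i)‖) * ∏ i, s i := by
        gcongr
        exact Finset.prod_nonneg fun i _ => hs i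
    _ = ∏ i, ‖A i (σ i)‖ * s (σ i) := by rw [Finset.prod_mul_distrib, Equiv.prod_comp σ s]

theorem exists_equiv_norm_mul_eq {κ : Type*} [Fintype κ] [DecidableEq κ]
    {A : Matrix ι κ R} {B : Matrix κ ι R} (hAB : A * B = 1) (hBA : B * A = 1) {r : ι → ℝ}
    {s : κ → ℝ} (hr : ∀ i, 0 < r i) (hA : ∀ i j, ‖A i j‖ * s j ≤ r i)
    (hB : ∀ j i, ‖B j i‖ * r i ≤ s j) : ∃ σ : ι ≃ κ, ∀ i, ‖A i (σ i)‖ * s (σ i) = r i := by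
  have : Nontrivial R := NormOneClass.nontrivial
  let e : ι ≃ κ := Fintype.equivOfCardEq (Matrix.square_of_invertible A B hAB hBA)
  have hAB' : A.submatrix id e * B.submatrix e id = 1 := by
    rw [Matrix.submatrix_mul_equiv, hAB, Matrix.submatrix_id_id]
  obtain ⟨σ, hσ⟩ := exists_perm_norm_mul_eq hAB' (s := s ∘ e) hr
    (fun i j => hA i (e j)) fun i j => hB (e i) j
  exact ⟨σ.trans e, hσ⟩

end Matrix

namespace TateAlgebra

variable {k : Type*} [NormedField k] [IsUltrametricDist k] {n m : ℕ}
  {r : Fin n → {x : ℝ // 0 < x}} {s : Fin m → {x : ℝ // 0 < x}}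

/-! ### Multiplicativity of the Gauss norm -/

/-- The size `|a_t| r^t` of the term of index `t` of a power series `∑ a_t T^t`. The Gauss norm is
the supremum of these sizes. -/
def termNorm (f : TateAlgebra k r) (t : Fin n →₀ ℕ) : ℝ :=
  ‖coeff t f.1‖ * t.prod (fun i m => (r i : ℝ) ^ m)

theorem termNorm_nonneg (f : TateAlgebra k r) (t : Fin n →₀ ℕ) : 0 ≤ termNorm f t :=
  mul_nonneg (norm_nonneg _) (weight_pos t).le

theorem termNorm_le_norm (f : TateAlgebra k r) (t : Fin n →₀ ℕ) : termNorm f t ≤ ‖f‖ :=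
  coeff_le f t

theorem finite_setOf_le_termNorm (f : TateAlgebra k r) {ε : ℝ} (hε : 0 < ε) :
    {t | ε ≤ termNorm f t}.Finite := by
  have h := (isRestricted f).eventually (gt_mem_nhds hε)
  simpa only [eventually_cofinite, not_lt, termNorm] using h

theorem exists_termNorm_eq_norm {f : TateAlgebra k r} (hf : f ≠ 0) :
    ∃ t, termNorm f t = ‖f‖ := by
  have hhalf : ‖f‖ / 2 < ‖f‖ := half_lt_self (norm_pos_iff.2 hf)
  obtain ⟨t₀, ht₀⟩ : ∃ t, ‖f‖ / 2 < termNorm f t := exists_lt_of_lt_ciSup hhalf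
  obtain ⟨t, ht, hmax⟩ := Set.exists_max_image _ (termNorm f)
    (finite_setOf_le_termNorm f (half_pos (norm_pos_iff.2 hf))) ⟨t₀, ht₀.le⟩
  refine ⟨t, (termNorm_le_norm f t).antisymm (norm_le_of_coeff f fun t' => ?_)⟩
  rcases le_or_gt (‖f‖ / 2) (termNorm f t') with h | h
  · exact hmax t' h
  · exact h.le.trans ht

theorem exists_lex_last_termNorm_eq_norm {f : TateAlgebra k r} (hf : f ≠ 0) :
    ∃ t, termNorm f t = ‖f‖ ∧ ∀ t', toLex t < toLex t' → termNorm f t' < ‖f‖ := by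
  have hfin : {t | termNorm f t = ‖f‖}.Finite :=
    (finite_setOf_le_termNorm f (norm_pos_iff.2 hf)).subset fun _ ht => ge_of_eq ht
  obtain ⟨t, ht, hmax⟩ := Set.exists_max_image _ toLex hfin (exists_termNorm_eq_norm hf)
  exact ⟨t, ht, fun t' hlt =>
    (termNorm_le_norm f t').lt_of_ne fun h => (hmax t' h).not_gt hlt⟩

theorem norm_coeff_mul_coeff_mul_prod (f g : TateAlgebra k r) (p q : Fin n →₀ ℕ) :
    ‖coeff p f.1 * coeff q g.1‖ * (p + q).prod (fun i m => (r i : ℝ) ^ m) =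
      termNorm f p * termNorm g q := by
  rw [norm_mul, Finsupp.prod_add_index' (fun _ => pow_zero _) (fun _ => pow_add _), termNorm,
    termNorm, mul_mul_mul_comm]

theorem termNorm_mul_termNorm_lt {f g : TateAlgebra k r} (hf : f ≠ 0) (hg : g ≠ 0)
    {p q : Fin n →₀ ℕ} (h : termNorm f p < ‖f‖ ∨ termNorm g q < ‖g‖) :
    termNorm f p * termNorm g q < ‖f‖ * ‖g‖ := by
  rcases h with h | h
  · exact mul_lt_mul_of_lt_of_le_of_nonneg_of_pos h (termNorm_le_norm g q)
      (termNorm_nonneg f p) (norm_pos_iff.2 hg)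
  · exact mul_lt_mul' (termNorm_le_norm f p) h (termNorm_nonneg g q) (norm_pos_iff.2 hf)

-- Among the pairs of indices with a given sum, the pair of lexicographically last maximal indices
-- of `f` and `g` strictly dominates, so that its contribution to `f * g` cannot cancel.
instance : NormMulClass (TateAlgebra k r) where
  norm_mul f g := by
    rcases eq_or_ne f 0 with rfl | hf
    · simp
    rcases eq_or_ne g 0 with rfl | hg
    · simp
    obtain ⟨i, hi, hi'⟩ := exists_lex_last_termNorm_eq_norm hf
    obtain ⟨j, hj, hj'⟩ := exists_lex_last_termNorm_eq_norm hg
    refine MvPowerSeries.gaussNorm_mul_eq_mul _ _ _ _ (hasGaussNorm f) (hasGaussNorm g)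
      (hasGaussNorm (f * g)) (fun _ => norm_nonneg _) norm_zero isNonarchimedean_norm
      norm_mul norm_neg (fun _ => norm_eq_zero.1) (fun i => (r i).2)
      ⟨i, j, hi, hj, fun ⟨p, q⟩ hpq hne => ?_⟩
    have hsum : p + q = i + j := Finset.HasAntidiagonal.mem_antidiagonal.1 hpq
    have hlex : toLex i < toLex p ∨ toLex j < toLex q := by
      by_contra! h
      obtain ⟨hp, hq⟩ := (add_eq_add_iff_eq_and_eq h.1 h.2).1 (congrArg toLex hsum)
      exact hne (Prod.ext (toLex.injective hp) (toLex.injective hq))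
    rw [← norm_mul]
    refine lt_of_mul_lt_mul_right (a := (i + j).prod fun i m => (r i : ℝ) ^ m) ?_
      (weight_pos _).le
    rw [norm_coeff_mul_coeff_mul_prod f g i j, ← hsum, norm_coeff_mul_coeff_mul_prod f g p q,
      hi, hj]
    exact termNorm_mul_termNorm_lt hf hg (hlex.imp (hi' p) (hj' q))

instance : Nontrivial (TateAlgebra k r) :=
  inferInstanceAs (Nontrivial (TateAlgebra k r).toSubring)

instance : NormOneClass (TateAlgebra k r) := NormMulClass.toNormOneClass

/-! ### The universal property -/

variable (k r) in
/-- The coordinate function `T_i` on the polydisc of polyradius `r`. -/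
def X (i : Fin n) : TateAlgebra k r :=
  ⟨MvPowerSeries.X i, MvPowerSeries.isRestricted_monomial _ _ _⟩

theorem norm_X_le (i : Fin n) : ‖X k r i‖ ≤ r i := by
  classical
  refine norm_le_of_coeff _ fun t => ?_
  rw [X, MvPowerSeries.coeff_X]
  split_ifs with h
  · simp [h]
  · simpa using (r i).2.le

theorem coe_aeval_X (p : MvPolynomial (Fin n) k) :
    (MvPolynomial.aeval (X k r) p : MvPowerSeries (Fin n) k) = p := by
  induction p using MvPolynomial.induction_on with
  | C a => simp only [MvPolynomial.algHom_C, MvPolynomial.coe_C]; rfl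
  | add p q hp hq => simp only [map_add, AddMemClass.coe_add, hp, hq, MvPolynomial.coe_add]
  | mul_X p i hp =>
    simp only [map_mul, MulMemClass.coe_mul, hp, MvPolynomial.aeval_X, X, MvPolynomial.coe_mul,
      MvPolynomial.coe_X]

theorem denseRange_aeval_X : DenseRange (MvPolynomial.aeval (R := k) (X k r)) := by
  classical
  refine Metric.denseRange_iff.2 fun f ε hε => ?_
  let large := (finite_setOf_le_termNorm f (half_pos hε)).toFinset
  refine ⟨∑ t ∈ large, MvPolynomial.monomial t (coeff t f.1), ?_⟩
  rw [dist_eq_norm]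
  refine (norm_le_of_coeff _ fun t => ?_).trans_lt (half_lt_self hε)
  rw [AddSubgroupClass.coe_sub, coe_aeval_X, map_sub, MvPolynomial.coeff_coe,
    MvPolynomial.coeff_sum]
  simp only [MvPolynomial.coeff_monomial, Finset.sum_ite_eq']
  split_ifs with h
  · simpa using (half_pos hε).le
  · rw [sub_zero]
    exact le_of_not_ge fun hle => h ((Set.Finite.mem_toFinset _).2 hle)

theorem algHom_ext {B : Type*} [Semiring B] [Algebra k B] [TopologicalSpace B] [T2Space B]
    {φ ψ : TateAlgebra k r →ₐ[k] B} (hφ : Continuous φ) (hψ : Continuous ψ)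
    (h : ∀ i, φ (X k r i) = ψ (X k r i)) : φ = ψ := by
  have hcomp : φ.comp (MvPolynomial.aeval (X k r)) = ψ.comp (MvPolynomial.aeval (X k r)) :=
    MvPolynomial.algHom_ext fun i => by simpa using h i
  exact DFunLike.coe_injective
    (denseRange_aeval_X.equalizer hφ hψ (congrArg DFunLike.coe hcomp))

section Lift

variable {B : Type*} [NormedCommRing B] [NormedAlgebra k B] [IsUltrametricDist B]
  [NormOneClass B] {b : Fin n → B}

theorem norm_aeval_le (hb : ∀ i, ‖b i‖ ≤ r i) (p : MvPolynomial (Fin n) k) :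
    ‖MvPolynomial.aeval b p‖ ≤ ‖MvPolynomial.aeval (X k r) p‖ := by
  rw [MvPolynomial.aeval_def, MvPolynomial.eval₂_eq']
  refine IsUltrametricDist.norm_sum_le_of_forall_le_of_nonneg (norm_nonneg _) fun t _ => ?_
  calc ‖algebraMap k B (p.coeff t) * ∏ i, b i ^ t i‖
      ≤ ‖p.coeff t‖ * ∏ i, ‖b i ^ t i‖ := by
        rw [← Algebra.smul_def]
        exact (norm_smul_le _ _).trans <| by gcongr; exact Finset.norm_prod_le _ _
    _ ≤ ‖p.coeff t‖ * ∏ i, (r i : ℝ) ^ t i := by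
        gcongr with i
        exact (norm_pow_le _ _).trans (pow_le_pow_left₀ (norm_nonneg _) (hb i) _)
    _ = termNorm (MvPolynomial.aeval (X k r) p) t := by
        rw [termNorm, coe_aeval_X, MvPolynomial.coeff_coe,
          Finsupp.prod_fintype _ _ fun _ => pow_zero _]
    _ ≤ ‖MvPolynomial.aeval (X k r) p‖ := termNorm_le_norm _ t

variable [CompleteSpace B]

/-- The continuous `k`-linear map `k{r⁻¹T} → B` that extends the evaluation of polynomials at
`b`. It is meaningful only for `|b_i| ≤ r_i`, where it underlies the homomorphism `lift`. -/
def liftCLM (b : Fin n → B) : TateAlgebra k r →L[k] B :=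
  (MvPolynomial.aeval (R := k) b).toLinearMap.extendOfNorm (MvPolynomial.aeval (X k r)).toLinearMap

theorem liftCLM_aeval_X (hb : ∀ i, ‖b i‖ ≤ r i) (p : MvPolynomial (Fin n) k) :
    liftCLM b (MvPolynomial.aeval (X k r) p) = MvPolynomial.aeval b p :=
  LinearMap.extendOfNorm_eq denseRange_aeval_X
    ⟨1, fun p => (norm_aeval_le hb p).trans_eq (one_mul _).symm⟩ p

theorem norm_liftCLM_le (hb : ∀ i, ‖b i‖ ≤ r i) (f : TateAlgebra k r) : ‖liftCLM b f‖ ≤ ‖f‖ :=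
  (LinearMap.norm_extendOfNorm_apply_le denseRange_aeval_X 1
    (fun p => (norm_aeval_le hb p).trans_eq (one_mul _).symm) f).trans_eq (one_mul _)

theorem liftCLM_mul (hb : ∀ i, ‖b i‖ ≤ r i) (f g : TateAlgebra k r) :
    liftCLM b (f * g) = liftCLM b f * liftCLM b g := by
  refine denseRange_aeval_X.induction_on₂ (isClosed_eq (by fun_prop) (by fun_prop))
    (fun p q => ?_) f g
  simp only [← map_mul, liftCLM_aeval_X hb]

/-- The homomorphism `k{r⁻¹T} → B` that sends `T_i` to `b_i`, for `|b_i| ≤ r_i`: the universal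
property of `k{r⁻¹T}`. -/
def lift (b : Fin n → B) (hb : ∀ i, ‖b i‖ ≤ r i) : TateAlgebra k r →ₐ[k] B :=
  AlgHom.ofLinearMap (liftCLM b).toLinearMap
    (by simpa using liftCLM_aeval_X (k := k) hb 1) (liftCLM_mul hb)

@[simp]
theorem lift_X (hb : ∀ i, ‖b i‖ ≤ r i) (i : Fin n) : lift (k := k) b hb (X k r i) = b i := by
  have h := liftCLM_aeval_X hb (MvPolynomial.X (R := k) i)
  rwa [MvPolynomial.aeval_X, MvPolynomial.aeval_X] at h

theorem norm_lift_le (hb : ∀ i, ‖b i‖ ≤ r i) (f : TateAlgebra k r) : ‖lift b hb f‖ ≤ ‖f‖ :=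
  norm_liftCLM_le hb f

theorem continuous_lift (hb : ∀ i, ‖b i‖ ≤ r i) : Continuous (lift (k := k) b hb) :=
  (liftCLM b).continuous

end Lift

/-! ### Changes of coordinates -/

theorem norm_X_add_algebraMap_le {a : k} {i : Fin n} (ha : ‖a‖ ≤ r i) :
    ‖X k r i + algebraMap k _ a‖ ≤ r i :=
  (IsUltrametricDist.norm_add_le_max _ _).trans <|
    max_le (norm_X_le i) ((norm_algebraMap' _ a).trans_le ha)

theorem norm_smul_X_le (a : k) (i : Fin n) : ‖a • X k r i‖ ≤ ‖a‖ * r i :=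
  (norm_smul_le _ _).trans (mul_le_mul_of_nonneg_left (norm_X_le i) (norm_nonneg a))

section ChangeOfCoordinates

variable [CompleteSpace k]

/-- The isomorphism `k{r⁻¹T} ≃ k{s⁻¹T}` given by two mutually inverse changes of coordinates
`T_i ↦ b_i` and `T_j ↦ c_j`. -/
def liftEquiv (b : Fin n → TateAlgebra k s) (c : Fin m → TateAlgebra k r)
    (hb : ∀ i, ‖b i‖ ≤ r i) (hc : ∀ j, ‖c j‖ ≤ s j)
    (hcb : ∀ i, lift c hc (b i) = X k r i) (hbc : ∀ j, lift b hb (c j) = X k s j) :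
    TateAlgebra k r ≃ₐ[k] TateAlgebra k s :=
  AlgEquiv.ofAlgHom (lift b hb) (lift c hc)
    (algHom_ext ((continuous_lift hb).comp (continuous_lift hc)) continuous_id fun j => by
      simp [hbc])
    (algHom_ext ((continuous_lift hc).comp (continuous_lift hb)) continuous_id fun i => by
      simp [hcb])

theorem isometry_liftEquiv {b : Fin n → TateAlgebra k s} {c : Fin m → TateAlgebra k r}
    (hb : ∀ i, ‖b i‖ ≤ r i) (hc : ∀ j, ‖c j‖ ≤ s j)
    (hcb : ∀ i, lift c hc (b i) = X k r i) (hbc : ∀ j, lift b hb (c j) = X k s j) :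
    Isometry (liftEquiv b c hb hc hcb hbc) :=
  isometry_of_norm_map_le_of_norm_inv_le _ (norm_lift_le hb) (norm_lift_le hc)

/-- The translation `T_i ↦ T_i + a_i` of the polydisc of polyradius `r`, for `|a_i| ≤ r_i`. -/
def translation (a : Fin n → k) (ha : ∀ i, ‖a i‖ ≤ r i) :
    TateAlgebra k r ≃ₐ[k] TateAlgebra k r :=
  liftEquiv (fun i => X k r i + algebraMap k _ (a i)) (fun i => X k r i + algebraMap k _ (-a i))
    (fun i => norm_X_add_algebraMap_le (ha i))
    (fun i => norm_X_add_algebraMap_le ((norm_neg _).trans_le (ha i)))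
    (fun i => by simp) (fun i => by simp)

theorem isometry_translation {a : Fin n → k} (ha : ∀ i, ‖a i‖ ≤ r i) :
    Isometry (translation a ha) :=
  isometry_liftEquiv _ _ _ _

theorem translation_X {a : Fin n → k} (ha : ∀ i, ‖a i‖ ≤ r i) (i : Fin n) :
    translation a ha (X k r i) = X k r i + algebraMap k _ (a i) :=
  lift_X (fun i => norm_X_add_algebraMap_le (ha i)) i

theorem exists_isometry_of_norm_eq {σ : Fin n ≃ Fin m} {a : Fin n → k} (ha₀ : ∀ i, a i ≠ 0)
    (ha : ∀ i, ‖a i‖ = (s (σ i) : ℝ) * (r i : ℝ)⁻¹) :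
    ∃ e : TateAlgebra k r ≃ₐ[k] TateAlgebra k s, Isometry e := by
  let b (i : Fin n) : TateAlgebra k s := (a i)⁻¹ • X k s (σ i)
  let c (j : Fin m) : TateAlgebra k r := a (σ.symm j) • X k r (σ.symm j)
  have hb (i) : ‖b i‖ ≤ r i := by
    refine (norm_smul_X_le _ _).trans_eq ?_
    rw [norm_inv, ha, mul_inv_rev, inv_inv, inv_mul_cancel_right₀ (s (σ i)).2.ne']
  have hc (j) : ‖c j‖ ≤ s j := by
    refine (norm_smul_X_le _ _).trans_eq ?_
    rw [ha, σ.apply_symm_apply, inv_mul_cancel_right₀ (r (σ.symm j)).2.ne']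
  exact ⟨_, isometry_liftEquiv hb hc (fun i => by simp [b, c, ha₀]) (fun j => by simp [b, c, ha₀])⟩

end ChangeOfCoordinates

/-! ### Linear parts at the origin -/

/-- The value at the origin, that is, the coefficient of `1`. -/
def constCoeff : TateAlgebra k r →ₐ[k] k where
  toRingHom := MvPowerSeries.constantCoeff.comp (TateAlgebra k r).val.toRingHom
  commutes' a := MvPowerSeries.constantCoeff_C (σ := Fin n) a

/-- The `j`-th partial derivative at the origin, that is, the coefficient of `T_j`. -/
def linCoeff (j : Fin n) : TateAlgebra k r →ₗ[k] k :=
  (coeff (Finsupp.single j 1)).comp (TateAlgebra k r).val.toLinearMap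

@[simp]
theorem constCoeff_X (i : Fin n) : constCoeff (X k r i) = 0 :=
  MvPowerSeries.coeff_zero_X i

theorem linCoeff_X (i j : Fin n) : linCoeff j (X k r i) = (1 : Matrix (Fin n) (Fin n) k) i j := by
  rw [Matrix.one_apply]
  exact (MvPowerSeries.coeff_index_single_X i j).trans (if_congr eq_comm rfl rfl)

theorem linCoeff_mul (j : Fin n) (f g : TateAlgebra k r) :
    linCoeff j (f * g) = constCoeff f • linCoeff j g + constCoeff g • linCoeff j f := by
  have h : coeff (Finsupp.single j 1) (f.1 * g.1) =
      coeff 0 f.1 * coeff (Finsupp.single j 1) g.1 +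
        coeff (Finsupp.single j 1) f.1 * coeff 0 g.1 := by
    classical
    simp [MvPowerSeries.coeff_mul, Finsupp.antidiagonal_single, Finset.Nat.antidiagonal_succ]
  exact h.trans (congrArg _ (mul_comm _ _))

theorem norm_constCoeff_le (f : TateAlgebra k r) : ‖constCoeff f‖ ≤ ‖f‖ := by
  have h := coeff_le f 0
  rwa [Finsupp.prod_zero_index, mul_one] at h

theorem norm_linCoeff_mul_le (j : Fin n) (f : TateAlgebra k r) :
    ‖linCoeff j f‖ * r j ≤ ‖f‖ := by
  have h := coeff_le f (Finsupp.single j 1)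
  rwa [Finsupp.prod_single_index (by exact pow_zero _), pow_one] at h

theorem continuous_constCoeff : Continuous (constCoeff (k := k) (r := r)) :=
  AddMonoidHomClass.continuous_of_bound _ 1 fun f =>
    (norm_constCoeff_le f).trans_eq (one_mul _).symm

theorem continuous_linCoeff (j : Fin n) : Continuous (linCoeff (k := k) (r := r) j) :=
  AddMonoidHomClass.continuous_of_bound _ (r j : ℝ)⁻¹ fun f => by
    rw [inv_mul_eq_div, le_div_iff₀ (r j).2]
    exact norm_linCoeff_mul_le j f

theorem eq_sum_linCoeff_smul {M : Type*} [AddCommGroup M] [Module k M] [TopologicalSpace M]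
    [T2Space M] [ContinuousAdd M] [ContinuousSMul k M] {D : TateAlgebra k r →ₗ[k] M}
    (hD : Continuous D)
    (hmul : ∀ f g, D (f * g) = constCoeff f • D g + constCoeff g • D f) (f : TateAlgebra k r) :
    D f = ∑ i, linCoeff i f • D (X k r i) := by
  refine denseRange_aeval_X.induction_on f (isClosed_eq hD ?_) fun p => ?_
  · exact continuous_finsetSum _ fun i _ => (continuous_linCoeff i).smul continuous_const
  induction p using MvPolynomial.induction_on with
  | C a =>
    have hD1 : D 1 = 0 := by simpa using hmul 1 1
    have hlin1 (i) : linCoeff i (1 : TateAlgebra k r) = 0 := by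
      simpa using linCoeff_mul (k := k) (r := r) i 1 1
    simp [Algebra.algebraMap_eq_smul_one, hD1, hlin1]
  | add p q hp hq => simp [hp, hq, add_smul, Finset.sum_add_distrib]
  | mul_X p i _ => simp [hmul, linCoeff_mul, linCoeff_X, Matrix.one_apply]

/-- The Jacobian matrix at the origin of the map of polydiscs given by `T_i ↦ φ(T_i)`. -/
def jacobian (φ : TateAlgebra k r →ₐ[k] TateAlgebra k s) : Matrix (Fin n) (Fin m) k :=
  Matrix.of fun i j => linCoeff j (φ (X k r i))

theorem jacobian_id : jacobian (AlgHom.id k (TateAlgebra k r)) = 1 :=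
  Matrix.ext (linCoeff_X (r := r))

theorem jacobian_comp {l : ℕ} {t : Fin l → {x : ℝ // 0 < x}}
    {ψ : TateAlgebra k s →ₐ[k] TateAlgebra k t} (hψ : Continuous ψ)
    (hψ₀ : constCoeff.comp ψ = constCoeff) (φ : TateAlgebra k r →ₐ[k] TateAlgebra k s) :
    jacobian (ψ.comp φ) = jacobian φ * jacobian ψ := by
  ext i j
  refine eq_sum_linCoeff_smul (D := (linCoeff j).comp ψ.toLinearMap)
    ((continuous_linCoeff j).comp hψ) (fun f g => ?_) (φ (X k r i))
  simp only [LinearMap.comp_apply, AlgHom.toLinearMap_apply, map_mul, linCoeff_mul,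
    ← AlgHom.comp_apply, hψ₀]

theorem norm_jacobian_mul_le {φ : TateAlgebra k r →ₐ[k] TateAlgebra k s}
    (hφ : ∀ f, ‖φ f‖ ≤ ‖f‖) (i : Fin n) (j : Fin m) : ‖jacobian φ i j‖ * s j ≤ r i :=
  (norm_linCoeff_mul_le j _).trans ((hφ _).trans (norm_X_le i))

/-! ### Isomorphisms of polydiscs -/

section Inverse

variable {e : TateAlgebra k r ≃ₐ[k] TateAlgebra k s}

theorem constCoeff_comp_symm (h₀ : constCoeff.comp e.toAlgHom = constCoeff) :
    constCoeff.comp e.symm.toAlgHom = constCoeff := by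
  rw [← h₀, AlgHom.comp_assoc, AlgEquiv.comp_symm, AlgHom.comp_id]

theorem jacobian_mul_jacobian_symm (he : Continuous e.symm)
    (h₀ : constCoeff.comp e.toAlgHom = constCoeff) :
    jacobian e.toAlgHom * jacobian e.symm.toAlgHom = 1 := by
  rw [← jacobian_comp he (constCoeff_comp_symm h₀), AlgEquiv.symm_comp, jacobian_id]

end Inverse

theorem exists_isometry_constCoeff_comp_eq [CompleteSpace k]
    {e : TateAlgebra k r ≃ₐ[k] TateAlgebra k s} (he : Isometry e) :
    ∃ e' : TateAlgebra k r ≃ₐ[k] TateAlgebra k s, Isometry e' ∧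
      constCoeff.comp e'.toAlgHom = constCoeff := by
  have ha (i) : ‖-constCoeff (e (X k r i))‖ ≤ r i :=
    calc ‖-constCoeff (e (X k r i))‖ = ‖constCoeff (e (X k r i))‖ := norm_neg _
      _ ≤ ‖e (X k r i)‖ := norm_constCoeff_le _
      _ = ‖X k r i‖ := he.norm_map_of_map_zero (map_zero e) _
      _ ≤ r i := norm_X_le i
  have he' : Isometry ((translation _ ha).trans e) := he.comp (isometry_translation ha)
  refine ⟨_, he', algHom_ext (continuous_constCoeff.comp he'.continuous) continuous_constCoeff
    fun i => ?_⟩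
  simp [translation_X]

theorem exists_equiv_norm_eq_of_isometry [CompleteSpace k]
    {e : TateAlgebra k r ≃ₐ[k] TateAlgebra k s} (he : Isometry e) :
    ∃ σ : Fin n ≃ Fin m, ∀ i, ∃ a : k, a ≠ 0 ∧ ‖a‖ = (s (σ i) : ℝ) * (r i : ℝ)⁻¹ := by
  obtain ⟨e, he, h₀⟩ := exists_isometry_constCoeff_comp_eq he
  have he' : Isometry e.symm := he.right_inv e.right_inv
  obtain ⟨σ, hσ⟩ := exists_equiv_norm_mul_eq (jacobian_mul_jacobian_symm he'.continuous h₀)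
    (jacobian_mul_jacobian_symm (e := e.symm) he.continuous (constCoeff_comp_symm h₀))
    (fun i => (r i).2)
    (norm_jacobian_mul_le fun f => (he.norm_map_of_map_zero (map_zero e) f).le)
    (norm_jacobian_mul_le fun f => (he'.norm_map_of_map_zero (map_zero e.symm) f).le)
  refine ⟨σ, fun i => ⟨(jacobian e.toAlgHom i (σ i))⁻¹, ?_, ?_⟩⟩
  · refine inv_ne_zero fun h => (r i).2.ne ?_
    rw [← hσ i, h, norm_zero, zero_mul]
  · rw [norm_inv, ← hσ i, mul_inv_rev, mul_inv_cancel_left₀ (s (σ i)).2.ne']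

theorem exists_isometry_iff [CompleteSpace k] :
    (∃ e : TateAlgebra k r ≃ₐ[k] TateAlgebra k s, Isometry e) ↔
      ∃ σ : Fin n ≃ Fin m, ∀ i, ∃ a : k, a ≠ 0 ∧ ‖a‖ = (s (σ i) : ℝ) * (r i : ℝ)⁻¹ := by
  refine ⟨fun ⟨_, he⟩ => exists_equiv_norm_eq_of_isometry he, fun ⟨_, h⟩ => ?_⟩
  choose a ha₀ ha using h
  exact exists_isometry_of_norm_eq ha₀ ha

end TateAlgebra

namespace AffinoidSpace

variable {k : Type*} [NormedField k] [IsUltrametricDist k] [CompleteSpace k] {n m : ℕ}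
  {r : Fin n → {x : ℝ // 0 < x}} {s : Fin m → {x : ℝ // 0 < x}}

variable (k r) in
/-- The Gauss point of the polydisc of polyradius `r`: the Gauss norm of `k{r⁻¹T}`, viewed as a
bounded multiplicative seminorm. -/
def gaussPoint : (polydisc k r).Points :=
  ⟨{ toFun := fun f : TateAlgebra k r => ‖f‖
     map_zero' := norm_zero
     add_le' := norm_add_le
     neg' := norm_neg
     map_one' := norm_one (α := TateAlgebra k r)
     map_mul' := norm_mul (α := TateAlgebra k r) }, fun _ => le_rfl⟩

theorem norm_comap_le {Y : AffinoidSpace k} (φ : polydisc k r ⟶ Y) (f : Y.functions) :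
    ‖(φ.comap f : TateAlgebra k r)‖ ≤ ‖f‖ :=
  φ.pullback_le (gaussPoint k r) f

/-- The isomorphism of affinoid algebras given by the pull-backs along an isomorphism of affinoid
spaces and along its inverse. -/
def comapEquiv {X Y : AffinoidSpace k} (e : X ≅ Y) : X.functions ≃ₐ[k] Y.functions :=
  AlgEquiv.ofAlgHom e.inv.comap e.hom.comap (congrArg Hom.comap e.inv_hom_id)
    (congrArg Hom.comap e.hom_inv_id)

theorem isometry_comapEquiv (e : polydisc k r ≅ polydisc k s) : Isometry (comapEquiv e) :=
  isometry_of_norm_map_le_of_norm_inv_le _ (norm_comap_le e.inv) (norm_comap_le e.hom)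

/-- The isomorphism of affinoid spaces dual to an isometric isomorphism of affinoid algebras. -/
def isoOfIsometry {X Y : AffinoidSpace k} (e : X.functions ≃ₐ[k] Y.functions) (he : Isometry e) :
    X ≅ Y where
  hom := ⟨e.symm.toAlgHom, 1, fun f =>
    ((he.right_inv e.right_inv).norm_map_of_map_zero (map_zero e.symm) f).trans_le
      (one_mul _).ge⟩
  inv := ⟨e.toAlgHom, 1, fun f =>
    (he.norm_map_of_map_zero (map_zero e) f).trans_le (one_mul _).ge⟩
  hom_inv_id := Hom.ext e.symm_comp
  inv_hom_id := Hom.ext e.comp_symm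

theorem nonempty_polydisc_iso_iff : Nonempty (polydisc k r ≅ polydisc k s) ↔
    ∃ e : TateAlgebra k r ≃ₐ[k] TateAlgebra k s, Isometry e :=
  ⟨fun ⟨e⟩ => ⟨comapEquiv e, isometry_comapEquiv e⟩, fun ⟨e, he⟩ => ⟨isoOfIsometry e he⟩⟩

end AffinoidSpace

end Berkovich

end

theorem mainTheorem7_general {k : Type*} [NormedField k] [IsUltrametricDist k] [CompleteSpace k]
    {n m : ℕ} (r : Fin n → {x : ℝ // 0 < x}) (s : Fin m → {x : ℝ // 0 < x})
    (X Y : Berkovich.AffinoidSpace k) (hX : X.IsClosedPolydisc r) (hY : Y.IsClosedPolydisc s) :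
    Nonempty (X ≅ Y) ↔
      ∃ σ : Fin n ≃ Fin m, ∀ i, ∃ a : k, a ≠ 0 ∧ ‖a‖ = (s (σ i) : ℝ) * (r i : ℝ)⁻¹ := by
  obtain ⟨eX⟩ := hX
  obtain ⟨eY⟩ := hY
  rw [(eX.isoCongr eY).nonempty_congr, Berkovich.AffinoidSpace.nonempty_polydisc_iso_iff,
    Berkovich.TateAlgebra.exists_isometry_iff]

theorem mainTheorem7 {k : Type*} [NormedField k] [IsUltrametricDist k] [CompleteSpace k]
    {n : ℕ} (r s : Fin n → {x : ℝ // 0 < x}) (X Y : Berkovich.AffinoidSpace k)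
    (hX : X.IsClosedPolydisc r) (hY : Y.IsClosedPolydisc s) :
    Nonempty (X ≅ Y) ↔
      ∃ σ : Equiv.Perm (Fin n), ∀ i, ∃ a : k, a ≠ 0 ∧ ‖a‖ = (s (σ i) : ℝ) * (r i : ℝ)⁻¹ :=
  mainTheorem7_general r s X Y hX hY
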